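/- For $\kappa>0$ put $s_\kappa(\theta)=\frac{1}{\sqrt\kappa}\sin(\sqrt\kappa\,\theta)$. Let $K>0$, $N\in(1,\infty)$, and let $D_{K,N}=\pi/\sqrt{K/(N-1)}$. For $0<D\le D_{K,N}$ let $h_{K,N,D}:\mathbb R\to[0,\infty)$ be the density $$h_{K,N,D}(x)=\begin{cases}s_{K/(N-1)}(D-x)^{N-1}, & x\in[0,D/2],\\ s_{K/(N-1)}(x)^{N-1}, & x\in[D/2,D],\\ 0,&\text{otherwise,}\end{cases}$$ and let $$\sigma^{(1/2)}_{K,N}(D)=\frac{s_{K/(N-1)}(D/2)}{s_{K/(N-1)}(D)}\ \text{ if } D<D_{K,N},\qquad \sigma^{(1/2)}_{K,N}(D_{K,N})=+\infty .$$ For a density $h\ge 0$ on $\mathbb R$ let $\lambda[h]$ be the Poincaré constant of the metric measure space $(\mathbb R,|\cdot|,h\,dx)$: $$\lambda[h]=\inf\left\{\frac{\int_{\mathbb R}|\nabla f|^2h\,dx}{\int_{\mathbb R}|f|^2h\,dx}\ :\ f:\mathbb R\to\mathbb R\text{ locally Lipschitz},\ \int_{\mathbb R} fh\,dx=0,\ 0<\int_{\mathbb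 R}|f|^2h\,dx<\infty\right\},$$ where $|\nabla f|(x)=\limsup_{y\to x}\frac{|f(y)-f(x)|}{|y-x|}$ (which equals $|f'(x)|$ for almost every $x$). **Lemma.** For all $K>0$, $N\in(1,\infty)$ and $0<D'\le D\le D_{K,N}$: $$(D')^2\,\lambda[h_{K,N,D'}]\ \le\ D^2\,\lambda[h_{K,N,D}]\ \le\ (D')^2\,\lambda[h_{K,N,D'}]\left(\frac{\sigma^{(1/2)}_{K,N}(D)}{\sigma^{(1/2)}_{K,N}(D')}\right)^{N-1},$$ where the second inequality is asserted for $D'<D_{K,N}$ (in the only remaining case $D'=D=D_{K,N}$ the quotient is the undefined expression $\infty/\infty$). When $D'<D=D_{K,N}$ the right-hand side equals $+\infty$. -/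

import Mathlib

open MeasureTheory Filter Topology
open scoped ENNReal

noncomputable section

/-- The local Lipschitz constant `limsup_{y → x, y ≠ x} |f y - f x| / d(y, x)`. At an isolated
point the punctured neighbourhood filter is `⊥`, and the value is `0`. -/
def localLip {X : Type*} [MetricSpace X] (f : X → ℝ) (x : X) : ℝ≥0∞ :=
  limsup (fun y => edist (f y) (f x) / edist y x) (𝓝[≠] x)

/-- The Poincaré constant of a metric measure space `(X, d, μ)`: the infimum of
`∫ |∇f|² dμ / ∫ |f|² dμ` over locally Lipschitz `f` of zero `μ`-mean with
`0 < ∫ |f|² dμ < ∞`. It is valued in `[0, ∞]` since the energy of `f` may be infinite. -/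
def poincareConst {X : Type*} [MetricSpace X] [MeasurableSpace X] (μ : Measure X) : ℝ≥0∞ :=
  ⨅ (f : X → ℝ) (_ : LocallyLipschitz f) (_ : Integrable f μ) (_ : ∫ x, f x ∂μ = 0)
    (_ : 0 < ∫⁻ x, ‖f x‖ₑ ^ 2 ∂μ) (_ : ∫⁻ x, ‖f x‖ₑ ^ 2 ∂μ < ∞),
    (∫⁻ x, localLip f x ^ 2 ∂μ) / (∫⁻ x, ‖f x‖ₑ ^ 2 ∂μ)

/-- `λ[h]`: the Poincaré constant of `(ℝ, |·|, h 𝓛¹)`, for a non-negative density `h`. -/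
def densityPoincareConst (h : ℝ → ℝ) : ℝ≥0∞ :=
  poincareConst ((volume : Measure ℝ).withDensity fun x => ENNReal.ofReal (h x))

/-- The function `s_κ`. -/
def sFun (κ θ : ℝ) : ℝ :=
  if 0 < κ then (1 / √κ) * Real.sin (√κ * θ)
  else if κ = 0 then θ
  else (1 / √(-κ)) * Real.sinh (√(-κ) * θ)

/-- The Bonnet–Myers diameter bound `D_{K,N}`. -/
def bonnetMyersDiam (K N : ℝ) : ℝ≥0∞ :=
  if 0 < K then ENNReal.ofReal (Real.pi / √(K / (N - 1))) else ∞

/-- The distortion coefficient of parameter `κ = K / (N - 1)` at time `t` and distance `θ`: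
`s_κ(t θ) / s_κ(θ)` below the Bonnet–Myers bound and `+∞` from there on. -/
def sigmaCoeff (K N t θ : ℝ) : ℝ≥0∞ :=
  if bonnetMyersDiam K N ≤ ENNReal.ofReal θ then ∞
  else ENNReal.ofReal (sFun (K / (N - 1)) (t * θ) / sFun (K / (N - 1)) θ)

/-- The model density `h_{K,N,D}`, supported on `[0, D]`. -/
def modelDensity (K N D x : ℝ) : ℝ :=
  if x ∈ Set.Icc 0 (D / 2) then sFun (K / (N - 1)) (D - x) ^ (N - 1)
  else if x ∈ Set.Icc (D / 2) D then sFun (K / (N - 1)) x ^ (N - 1)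
  else 0

end

/-! Dilating by `D` turns `D² λ[h_{K,N,D}]` into the Poincaré constant on `[0, 1]` of the density
`sin(c v)^(N-1)`, where `c = √κ D`, `κ = K/(N-1)` and `v = max(u, 1-u)`; a constant factor of the
density is irrelevant. For `a = √κ D'` and `b = √κ D` the two densities differ by the weight `ρ =
(sin(b v) / sin(a v))^(N-1)`, which is non-increasing in `v` (`antitoneOn_sin_mul_div_sin_mul`).
Both inequalities follow from this monotonicity.

Lower bound (`poincareConst_withDensity_le_mul_antitone`): for a symmetric density, testing with odd
functions frozen beyond `t` gives a Poincaré inequality on each `[1/2, t]` for functions vanishing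
at `1/2`, with the same constant. As `ρ` decreases away from `1/2`, its superlevel sets in `[1/2,
∞)` are such initial segments, so the layer-cake formula sums these inequalities into one with
weight `ρ`.

Upper bound (`poincareConst_le_of_smul_le_of_le_smul`): changing a density by a factor between `m`
and `M` changes the constant by at most `M/m`. Here `M` and `m` are the values of `ρ` at `v = 1/2`
and `v = 1`, and their quotient is the quotient of the coefficients `σ`, to the power `N-1`. At the
Bonnet–Myers diameter this factor is infinite, and positivity of the constant for `D'` is what
remains to be shown. -/

/-! ### Local Lipschitz constants and the Poincaré inequality on the line -/

theorem localLip_eq_enorm_deriv {f : ℝ → ℝ} {x : ℝ} (h : DifferentiableAt ℝ f x) :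
    localLip f x = ‖deriv f x‖ₑ := by
  have h1 : Tendsto (fun y => ‖slope f x y‖ₑ) (𝓝[≠] x) (𝓝 ‖deriv f x‖ₑ) :=
    (continuous_enorm.tendsto _).comp (hasDerivAt_iff_tendsto_slope.1 h.hasDerivAt)
  rw [← h1.limsup_eq]
  refine limsup_congr ?_
  filter_upwards [self_mem_nhdsWithin] with y hy
  have hy' : y - x ≠ 0 := sub_ne_zero.2 hy
  rw [slope_def_field, edist_eq_enorm_sub, edist_eq_enorm_sub, div_eq_mul_inv,
    div_eq_mul_inv, enorm_mul, enorm_inv hy']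

theorem LocallyLipschitz.exists_lipschitzOnWith_Icc {f : ℝ → ℝ} (hf : LocallyLipschitz f)
    (a b : ℝ) : ∃ C, LipschitzOnWith C f (Set.Icc a b) :=
  LocallyLipschitzOn.exists_lipschitzOnWith_of_compact isCompact_Icc
    (hf.locallyLipschitzOn.mono (Set.subset_univ _))

theorem LocallyLipschitz.ae_differentiableAt {f : ℝ → ℝ} (hf : LocallyLipschitz f) :
    ∀ᵐ x, DifferentiableAt ℝ f x := by
  have h : ∀ n : ℕ, ∀ᵐ x, x ∈ Set.Icc (-(n : ℝ)) n → DifferentiableWithinAt ℝ f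
      (Set.Icc (-(n : ℝ)) n) x := fun n => by
    obtain ⟨C, hC⟩ := hf.exists_lipschitzOnWith_Icc (-(n : ℝ)) n
    exact hC.ae_differentiableWithinAt_of_mem_real
  filter_upwards [ae_all_iff.2 h] with x hx
  obtain ⟨n, hn⟩ := exists_nat_gt |x|
  have := abs_lt.1 hn
  exact (hx n ⟨this.1.le, this.2.le⟩).differentiableAt (Icc_mem_nhds this.1 this.2)

theorem lintegral_localLip_sq {f : ℝ → ℝ} (hf : LocallyLipschitz f) {μ : Measure ℝ}
    (hμ : μ ≪ volume) : ∫⁻ x, localLip f x ^ 2 ∂μ = ∫⁻ x, ‖deriv f x‖ₑ ^ 2 ∂μ := by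
  refine lintegral_congr_ae (hμ.ae_le ?_)
  filter_upwards [hf.ae_differentiableAt] with x hx
  rw [localLip_eq_enorm_deriv hx]

/-- The Poincaré inequality with the optimal constant. -/
theorem poincareConst_mul_le {μ : Measure ℝ} (hμ : μ ≪ volume) {f : ℝ → ℝ}
    (hf : LocallyLipschitz f) (hi : Integrable f μ) (h0 : ∫ x, f x ∂μ = 0)
    (h2 : ∫⁻ x, ‖f x‖ₑ ^ 2 ∂μ < ∞) :
    poincareConst μ * ∫⁻ x, ‖f x‖ₑ ^ 2 ∂μ ≤ ∫⁻ x, ‖deriv f x‖ₑ ^ 2 ∂μ := by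
  rcases eq_or_ne (∫⁻ x, ‖f x‖ₑ ^ 2 ∂μ) 0 with h | h
  · simp [h]
  · rw [← ENNReal.le_div_iff_mul_le (Or.inl h) (Or.inl h2.ne), ← lintegral_localLip_sq hf hμ]
    exact iInf₂_le_of_le f hf (iInf₂_le_of_le hi h0 (iInf₂_le_of_le (pos_iff_ne_zero.2 h) h2 le_rfl))

theorem le_poincareConst {μ : Measure ℝ} (hμ : μ ≪ volume) {a : ℝ≥0∞}
    (h : ∀ f : ℝ → ℝ, LocallyLipschitz f → Integrable f μ → ∫ x, f x ∂μ = 0 →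
      ∫⁻ x, ‖f x‖ₑ ^ 2 ∂μ < ∞ →
      a * ∫⁻ x, ‖f x‖ₑ ^ 2 ∂μ ≤ ∫⁻ x, ‖deriv f x‖ₑ ^ 2 ∂μ) :
    a ≤ poincareConst μ := by
  refine le_iInf₂ fun f hf => le_iInf₂ fun hi h0 => le_iInf₂ fun h1 h2 => ?_
  rw [ENNReal.le_div_iff_mul_le (Or.inl h1.ne') (Or.inl h2.ne), lintegral_localLip_sq hf hμ]
  exact h f hf hi h0 h2

theorem lintegral_enorm_sq_eq_ofReal {μ : Measure ℝ} {f : ℝ → ℝ}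
    (hf : Integrable (fun x => f x ^ 2) μ) :
    ∫⁻ x, ‖f x‖ₑ ^ 2 ∂μ = ENNReal.ofReal (∫ x, f x ^ 2 ∂μ) := by
  rw [ofReal_integral_eq_lintegral_ofReal hf (ae_of_all _ fun x => sq_nonneg _)]
  refine lintegral_congr fun x => ?_
  rw [Real.enorm_eq_ofReal_abs, ← ENNReal.ofReal_pow (abs_nonneg _), sq_abs]

/-- The mean minimises the quadratic deviation. -/
theorem lintegral_enorm_sq_le_sub_const {μ : Measure ℝ} [IsFiniteMeasure μ] {f : ℝ → ℝ}
    (hf : Integrable f μ) (hf2 : Integrable (fun x => f x ^ 2) μ) (h0 : ∫ x, f x ∂μ = 0) (c : ℝ) :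
    ∫⁻ x, ‖f x‖ₑ ^ 2 ∂μ ≤ ∫⁻ x, ‖f x - c‖ₑ ^ 2 ∂μ := by
  have he : (fun x => (f x - c) ^ 2) = fun x => f x ^ 2 - 2 * c * f x + c ^ 2 := by
    ext x; ring
  have hi : Integrable (fun x => f x ^ 2 - 2 * c * f x) μ := hf2.sub (hf.const_mul _)
  have hs : Integrable (fun x => (f x - c) ^ 2) μ := by
    rw [he]; exact hi.add (integrable_const _)
  rw [lintegral_enorm_sq_eq_ofReal hf2, lintegral_enorm_sq_eq_ofReal hs]
  refine ENNReal.ofReal_le_ofReal ?_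
  rw [he, integral_add hi (integrable_const _), integral_sub hf2 (hf.const_mul _),
    integral_const_mul, h0, integral_const]
  have : 0 ≤ μ.real Set.univ • c ^ 2 := by positivity
  linarith

theorem Continuous.integrable_of_measure_compl_Icc {μ : Measure ℝ} [IsFiniteMeasure μ] {a b : ℝ}
    (hμ : μ (Set.Icc a b)ᶜ = 0) {f : ℝ → ℝ} (hf : Continuous f) : Integrable f μ := by
  rw [← Measure.restrict_eq_self_of_ae_mem (μ := μ) (s := Set.Icc a b)
    (measure_eq_zero_iff_ae_notMem.1 hμ |>.mono fun _ hx => not_not.1 hx)]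
  exact hf.continuousOn.integrableOn_compact isCompact_Icc

/-- The inequality `poincareConst_mul_le` on a bounded interval, where a locally Lipschitz function
satisfies every integrability condition. -/
theorem poincareConst_mul_le_of_Icc {μ : Measure ℝ} [IsFiniteMeasure μ] (hμ : μ ≪ volume) {a b : ℝ}
    (hab : μ (Set.Icc a b)ᶜ = 0) {f : ℝ → ℝ} (hf : LocallyLipschitz f)
    (h0 : ∫ x, f x ∂μ = 0) :
    poincareConst μ * ∫⁻ x, ‖f x‖ₑ ^ 2 ∂μ ≤ ∫⁻ x, ‖deriv f x‖ₑ ^ 2 ∂μ := by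
  refine poincareConst_mul_le hμ hf (hf.continuous.integrable_of_measure_compl_Icc hab) h0 ?_
  rw [lintegral_enorm_sq_eq_ofReal ((hf.continuous.pow 2).integrable_of_measure_compl_Icc hab)]
  exact ENNReal.ofReal_lt_top

/-- On a bounded interval it is enough to bound the quadratic deviation from some constant. -/
theorem le_poincareConst_of_Icc {μ : Measure ℝ} [IsFiniteMeasure μ] (hμ : μ ≪ volume) {a b : ℝ}
    (hab : μ (Set.Icc a b)ᶜ = 0) {k : ℝ≥0∞}
    (h : ∀ f : ℝ → ℝ, LocallyLipschitz f → ∃ c : ℝ,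
      k * ∫⁻ x, ‖f x - c‖ₑ ^ 2 ∂μ ≤ ∫⁻ x, ‖deriv f x‖ₑ ^ 2 ∂μ) :
    k ≤ poincareConst μ := by
  refine le_poincareConst hμ fun f hf hi h0 _ => ?_
  obtain ⟨c, hc⟩ := h f hf
  refine le_trans ?_ hc
  exact mul_le_mul_right (lintegral_enorm_sq_le_sub_const hi
    ((hf.continuous.pow 2).integrable_of_measure_compl_Icc hab) h0 c) k

/-! ### Dilations -/

/-- Test with `u ↦ f (c * u)`: the Jacobian `c⁻¹` appears on both sides and cancels, and the chain
rule leaves `c ^ 2`. The reverse inequality is this one for `c⁻¹`. -/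
theorem poincareConst_withDensity_comp_mul_le {ω : ℝ → ℝ≥0∞} {c : ℝ}
    (hc : 0 < c) :
    poincareConst ((volume : Measure ℝ).withDensity fun u => ω (c * u)) ≤
      ENNReal.ofReal (c ^ 2) * poincareConst ((volume : Measure ℝ).withDensity ω) := by
  set μ := (volume : Measure ℝ).withDensity ω
  set ν := (volume : Measure ℝ).withDensity fun u => ω (c * u)
  have hc2 : ENNReal.ofReal (c ^ 2) ≠ 0 := by simp [hc.ne']
  have hci : ENNReal.ofReal c⁻¹ ≠ 0 := by simp [hc]
  have hmap : ν.map (fun u => c * u) = ENNReal.ofReal c⁻¹ • μ := by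
    have h1 := Real.map_volume_mul_left hc.ne'
    rw [abs_of_pos (inv_pos.2 hc)] at h1
    have he : MeasurableEmbedding (fun u : ℝ => c * u) :=
      (Homeomorph.mulLeft₀ c hc.ne').measurableEmbedding
    ext s hs
    rw [he.map_apply, withDensity_apply _ (he.measurable hs), Measure.smul_apply,
      withDensity_apply _ hs, ← lintegral_smul_measure, ← Measure.restrict_smul, ← h1,
      he.restrict_map, he.lintegral_map]
  have he : MeasurableEmbedding (fun u : ℝ => c * u) :=
    (Homeomorph.mulLeft₀ c hc.ne').measurableEmbedding
  have hlin : ∀ F : ℝ → ℝ≥0∞, ∫⁻ u, F (c * u) ∂ν = ENNReal.ofReal c⁻¹ * ∫⁻ x, F x ∂μ := fun F => by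
    rw [← he.lintegral_map, hmap, lintegral_smul_measure, smul_eq_mul]
  rw [mul_comm, ← ENNReal.div_le_iff hc2 ENNReal.ofReal_ne_top]
  refine le_poincareConst (withDensity_absolutelyContinuous _ _) fun f hf hi h0 h2 => ?_
  have hF : LocallyLipschitz fun u => f (c * u) :=
    hf.comp (lipschitzWith_smul (α := ℝ) (β := ℝ) c).locallyLipschitz
  have key := poincareConst_mul_le (μ := ν) (withDensity_absolutelyContinuous _ _) hF
    (by
      rw [← Function.comp_def f (fun u => c * u), ← he.integrable_map_iff, hmap]
      exact hi.smul_measure ENNReal.ofReal_ne_top)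
    (by rw [← he.integral_map (g := f), hmap, integral_smul_measure, h0, smul_zero])
    (by rw [hlin fun x => ‖f x‖ₑ ^ 2]; exact ENNReal.mul_lt_top ENNReal.ofReal_lt_top h2)
  have hd : ∀ u, ‖deriv (fun u => f (c * u)) u‖ₑ ^ 2 =
      ENNReal.ofReal (c ^ 2) * ‖deriv f (c * u)‖ₑ ^ 2 := fun u => by
    rw [deriv_comp_mul_left, smul_eq_mul, enorm_mul, mul_pow, Real.enorm_eq_ofReal hc.le,
      ENNReal.ofReal_pow hc.le]
  simp only [hd] at key
  rw [hlin fun x => ‖f x‖ₑ ^ 2, lintegral_const_mul' _ _ ENNReal.ofReal_ne_top,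
    hlin fun x => ‖deriv f x‖ₑ ^ 2, mul_left_comm, mul_left_comm (ENNReal.ofReal (c ^ 2)),
    ENNReal.mul_le_mul_iff_right hci ENNReal.ofReal_ne_top] at key
  rw [div_eq_mul_inv, mul_right_comm, ← div_eq_mul_inv]
  exact ENNReal.div_le_of_le_mul' key

theorem poincareConst_withDensity_comp_mul {ω : ℝ → ℝ≥0∞} {c : ℝ}
    (hc : 0 < c) :
    poincareConst ((volume : Measure ℝ).withDensity fun u => ω (c * u)) =
      ENNReal.ofReal (c ^ 2) * poincareConst ((volume : Measure ℝ).withDensity ω) := by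
  refine le_antisymm (poincareConst_withDensity_comp_mul_le hc) ?_
  have h := poincareConst_withDensity_comp_mul_le (ω := fun u => ω (c * u))
    (inv_pos.2 hc)
  simp only [mul_inv_cancel_left₀ hc.ne'] at h
  calc _ ≤ ENNReal.ofReal (c ^ 2) * (ENNReal.ofReal (c⁻¹ ^ 2) * _) := by gcongr
    _ = _ := by
      rw [← mul_assoc, ← ENNReal.ofReal_mul (by positivity), ← mul_pow, mul_inv_cancel₀ hc.ne']
      simp

/-! ### Symmetric densities and weights decreasing away from the centre -/

theorem LocallyLipschitz.fun_sub {f g : ℝ → ℝ} (hf : LocallyLipschitz f)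
    (hg : LocallyLipschitz g) : LocallyLipschitz fun x => f x - g x :=
  ((LipschitzWith.prod_fst (α := ℝ) (β := ℝ)).sub LipschitzWith.prod_snd).locallyLipschitz.comp
    (hf.prodMk hg)

theorem setLIntegral_Iio_half_eq_Ici (φ : ℝ → ℝ≥0∞) :
    ∫⁻ u in Set.Iio (1 / 2), φ u = ∫⁻ u in Set.Ici (1 / 2), φ (1 - u) := by
  have h := (Measure.measurePreserving_sub_left (volume : Measure ℝ) 1).setLIntegral_comp_preimage_emb
    (Homeomorph.subLeft (1 : ℝ)).measurableEmbedding φ (Set.Iio (1 / 2))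
  rw [← h, ← restrict_Ioi_eq_restrict_Ici]
  congr 2
  ext u
  simp only [Set.mem_preimage, Set.mem_Iio, Set.mem_Ioi]
  constructor <;> intro _ <;> linarith

theorem lintegral_eq_setLIntegral_Ici_half_add (φ : ℝ → ℝ≥0∞) :
    ∫⁻ u, φ u = (∫⁻ u in Set.Ici (1 / 2), φ u) + ∫⁻ u in Set.Ici (1 / 2), φ (1 - u) := by
  rw [← setLIntegral_Iio_half_eq_Ici, ← Set.compl_Ici, lintegral_add_compl _ measurableSet_Ici]

theorem lintegral_eq_two_mul_of_symm {φ : ℝ → ℝ≥0∞} (h : ∀ u, φ (1 - u) = φ u) :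
    ∫⁻ u, φ u = 2 * ∫⁻ u in Set.Ici (1 / 2), φ u := by
  rw [lintegral_eq_setLIntegral_Ici_half_add]
  simp only [h, two_mul]

/-- A comparison of integrals over all initial segments extends to integrals against an
antitone weight. -/
theorem setLIntegral_antitone_mul_le {a b : ℝ → ℝ≥0∞} (ha : Measurable a) (hb : Measurable b)
    {x₀ : ℝ} (h : ∀ t ≥ x₀, ∫⁻ u in Set.Icc x₀ t, a u ≤ ∫⁻ u in Set.Icc x₀ t, b u)
    {ρ : ℝ → ℝ} (hρm : Measurable ρ) (hρ0 : ∀ u, 0 ≤ ρ u) (hρ : AntitoneOn ρ (Set.Ici x₀)) :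
    ∫⁻ u in Set.Ici x₀, a u * ENNReal.ofReal (ρ u) ≤
      ∫⁻ u in Set.Ici x₀, b u * ENNReal.ofReal (ρ u) := by
  -- Such an `S` is an initial segment: if bounded, it agrees up to a null set with a closed one; if
  -- not, it is an increasing union of them.
  have hS : ∀ S ⊆ Set.Ici x₀, (∀ x ∈ S, Set.Icc x₀ x ⊆ S) →
      ∫⁻ u in S, a u ≤ ∫⁻ u in S, b u := by
    intro S hS0 hS
    rcases S.eq_empty_or_nonempty with rfl | hne
    · simp
    by_cases hbd : BddAbove S
    · have ht : x₀ ≤ sSup S := hne.elim fun y hy => (hS0 hy).trans (le_csSup hbd hy)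
      have hae : S =ᵐ[volume] Set.Icc x₀ (sSup S) := by
        refine (LE.le.eventuallyLE (show S ≤ Set.Icc x₀ (sSup S) from
          fun y hy => ⟨hS0 hy, le_csSup hbd hy⟩)).antisymm ?_
        refine Ico_ae_eq_Icc.symm.le.trans (LE.le.eventuallyLE (show Set.Ico x₀ (sSup S) ≤ S from
          fun y hy => ?_))
        obtain ⟨z, hz, hyz⟩ := exists_lt_of_lt_csSup hne hy.2
        exact hS z hz ⟨hy.1, hyz.le⟩
      rw [setLIntegral_congr hae, setLIntegral_congr hae]
      exact h _ ht
    · have hU : S = ⋃ n : ℕ, Set.Icc x₀ (x₀ + n) := by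
        refine Set.Subset.antisymm (fun y hy => ?_) (Set.iUnion_subset fun n => ?_)
        · obtain ⟨n, hn⟩ := exists_nat_ge (y - x₀)
          exact Set.mem_iUnion.2 ⟨n, hS0 hy, by linarith⟩
        · obtain ⟨z, hz, hzn⟩ := not_bddAbove_iff.1 hbd (x₀ + n)
          exact (Set.Icc_subset_Icc_right hzn.le).trans (hS z hz)
      have hdir : Directed (· ⊆ ·) fun n : ℕ => Set.Icc x₀ (x₀ + n) :=
        Monotone.directed_le fun m n hmn => Set.Icc_subset_Icc_right (by gcongr)
      rw [hU, setLIntegral_iUnion_of_directed _ hdir, setLIntegral_iUnion_of_directed _ hdir]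
      exact iSup_mono fun n => h _ (by simp)
  -- Layer-cake formula for `ρ` against the measure with density `c`.
  have hcake : ∀ c : ℝ → ℝ≥0∞, Measurable c → ∫⁻ u in Set.Ici x₀, c u * ENNReal.ofReal (ρ u) =
      ∫⁻ s in Set.Ioi (0 : ℝ), ∫⁻ u in {u | s < ρ u} ∩ Set.Ici x₀, c u := by
    intro c hc
    have hm : ∀ s, MeasurableSet {u | s < ρ u} := fun s => measurableSet_lt measurable_const hρm
    have := lintegral_eq_lintegral_meas_lt ((volume.restrict (Set.Ici x₀)).withDensity c)
      (f := ρ) (ae_of_all _ hρ0) hρm.aemeasurable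
    rw [lintegral_withDensity_eq_lintegral_mul _ hc hρm.ennreal_ofReal] at this
    simp only [Pi.mul_apply, withDensity_apply _ (hm _), Measure.restrict_restrict (hm _)] at this
    exact this
  rw [hcake a ha, hcake b hb]
  refine lintegral_mono fun s => hS _ Set.inter_subset_right ?_
  rintro x ⟨hx, hx0⟩ y hy
  exact ⟨lt_of_lt_of_le hx (hρ hy.1 hx0 hy.2), hy.1⟩

/-- The odd reflection about `1 / 2` of `g`, frozen beyond `t`. -/
noncomputable def oddTruncation (g : ℝ → ℝ) (t u : ℝ) : ℝ :=
  g (max (1 / 2) (min u t)) - g (max (1 / 2) (min (1 - u) t))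

theorem LocallyLipschitz.oddTruncation {g : ℝ → ℝ} (hg : LocallyLipschitz g) (t : ℝ) :
    LocallyLipschitz (oddTruncation g t) := by
  have h : LocallyLipschitz fun u : ℝ => max (1 / 2) (min u t) :=
    (LocallyLipschitz.id.min_const t).const_max _
  have h' : LocallyLipschitz fun u : ℝ => 1 - u := (LocallyLipschitz.const 1).fun_sub .id
  exact (hg.comp h).fun_sub ((hg.comp h).comp h')

theorem oddTruncation_one_sub (g : ℝ → ℝ) (t u : ℝ) :
    oddTruncation g t (1 - u) = -oddTruncation g t u := by
  simp [oddTruncation]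

theorem deriv_oddTruncation_one_sub (g : ℝ → ℝ) (t u : ℝ) :
    deriv (oddTruncation g t) (1 - u) = deriv (oddTruncation g t) u := by
  have h := deriv_comp_const_sub (f := oddTruncation g t) 1 u
  simp only [oddTruncation_one_sub] at h
  rw [deriv.fun_neg] at h
  linarith

theorem oddTruncation_of_mem {g : ℝ → ℝ} (hg : g (1 / 2) = 0) {t u : ℝ}
    (hu : u ∈ Set.Icc (1 / 2) t) : oddTruncation g t u = g u := by
  have h1 := hu.1
  rw [oddTruncation, min_eq_left hu.2, max_eq_right hu.1,
    max_eq_left ((min_le_left _ _).trans (by linarith)), hg, sub_zero]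

theorem oddTruncation_of_le {g : ℝ → ℝ} (hg : g (1 / 2) = 0) {t u : ℝ} (ht : 1 / 2 ≤ t)
    (hu : t ≤ u) : oddTruncation g t u = g t := by
  rw [oddTruncation, min_eq_right hu, max_eq_right ht,
    max_eq_left ((min_le_left _ _).trans (by linarith)), hg, sub_zero]

theorem withDensity_compl_Icc_eq_zero {ω : ℝ → ℝ≥0∞} (hsupp : ∀ u ∉ Set.Icc (0 : ℝ) 1, ω u = 0) :
    (volume : Measure ℝ).withDensity ω (Set.Icc 0 1)ᶜ = 0 := by
  rw [withDensity_apply _ measurableSet_Icc.compl]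
  exact setLIntegral_eq_zero measurableSet_Icc.compl hsupp

/-- The odd truncation has zero mean by symmetry, so it is an admissible test function. Beyond `t`
it is constant: it has no energy there, and its square mass there can be dropped. -/
theorem poincareConst_mul_setLIntegral_Icc_le {ω : ℝ → ℝ≥0∞} (hω : Measurable ω)
    [IsFiniteMeasure ((volume : Measure ℝ).withDensity ω)]
    (hsymm : ∀ u, ω (1 - u) = ω u) (hsupp : ∀ u ∉ Set.Icc (0 : ℝ) 1, ω u = 0)
    {g : ℝ → ℝ} (hg : LocallyLipschitz g) (hg0 : g (1 / 2) = 0) {t : ℝ} (ht : 1 / 2 ≤ t) :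
    poincareConst ((volume : Measure ℝ).withDensity ω) *
        ∫⁻ u in Set.Icc (1 / 2) t, ω u * ‖g u‖ₑ ^ 2 ≤
      ∫⁻ u in Set.Icc (1 / 2) t, ω u * ‖deriv g u‖ₑ ^ 2 := by
  set μ := (volume : Measure ℝ).withDensity ω
  set G := oddTruncation g t
  have hG : LocallyLipschitz G := hg.oddTruncation t
  have hmp : MeasurePreserving (fun u : ℝ => 1 - u) μ μ := by
    refine ⟨by fun_prop, ?_⟩
    have hp := Measure.measurePreserving_sub_left (volume : Measure ℝ) 1
    have he := (Homeomorph.subLeft (1 : ℝ)).measurableEmbedding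
    ext s hs
    rw [Measure.map_apply (by fun_prop) hs, withDensity_apply _ (hs.preimage (by fun_prop)),
      withDensity_apply _ hs, ← hp.setLIntegral_comp_preimage_emb he ω s]
    simp only [hsymm]
  have hmean : ∫ u, G u ∂μ = 0 := by
    have h := hmp.integral_comp (Homeomorph.subLeft (1 : ℝ)).measurableEmbedding G
    simp only [G, oddTruncation_one_sub, integral_neg] at h
    linarith
  have key := poincareConst_mul_le_of_Icc (withDensity_absolutelyContinuous _ _)
    (withDensity_compl_Icc_eq_zero hsupp) hG hmean
  rw [lintegral_withDensity_eq_lintegral_mul _ hω (by have := hG.continuous; fun_prop),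
    lintegral_withDensity_eq_lintegral_mul _ hω (by have := measurable_deriv G; fun_prop)] at key
  simp only [Pi.mul_apply] at key
  rw [lintegral_eq_two_mul_of_symm (fun u => by simp only [G, hsymm, oddTruncation_one_sub, enorm_neg]),
    lintegral_eq_two_mul_of_symm (fun u => by simp only [G, hsymm, deriv_oddTruncation_one_sub]),
    mul_left_comm, ENNReal.mul_le_mul_iff_right two_ne_zero ENNReal.ofNat_ne_top] at key
  have h1 : ∫⁻ u in Set.Icc (1 / 2) t, ω u * ‖g u‖ₑ ^ 2 ≤
      ∫⁻ u in Set.Ici (1 / 2), ω u * ‖G u‖ₑ ^ 2 := by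
    rw [setLIntegral_congr_fun (g := fun u => ω u * ‖G u‖ₑ ^ 2) measurableSet_Icc
      (fun u hu => by simp only [G, oddTruncation_of_mem hg0 hu])]
    exact lintegral_mono_set Set.Icc_subset_Ici_self
  have h2 : ∫⁻ u in Set.Ici (1 / 2), ω u * ‖deriv G u‖ₑ ^ 2 =
      ∫⁻ u in Set.Icc (1 / 2) t, ω u * ‖deriv g u‖ₑ ^ 2 := by
    rw [← Set.inter_eq_left.2 (Set.Icc_subset_Ici_self (a := t) (b := (1 / 2 : ℝ))),
      ← setLIntegral_indicator measurableSet_Icc]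
    -- The derivatives are compared off the gluing points `1 / 2` and `t`.
    refine setLIntegral_congr_fun_ae measurableSet_Ici ?_
    filter_upwards [Measure.ae_ne volume (1 / 2 : ℝ), Measure.ae_ne volume t] with u hu1 hut hu
    have hu1 : 1 / 2 < u := lt_of_le_of_ne hu hu1.symm
    rcases lt_or_gt_of_ne hut with hlt | hgt
    · rw [Set.indicator_of_mem (Set.mem_Icc.2 ⟨hu, hlt.le⟩)]
      have : G =ᶠ[𝓝 u] g := by
        filter_upwards [Ioo_mem_nhds hu1 hlt] with y hy
        exact oddTruncation_of_mem hg0 ⟨hy.1.le, hy.2.le⟩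
      rw [this.deriv_eq]
    · rw [Set.indicator_of_notMem fun h => h.2.not_gt hgt]
      have : G =ᶠ[𝓝 u] fun _ => g t := by
        filter_upwards [Ioi_mem_nhds hgt] with y hy
        exact oddTruncation_of_le hg0 ht (le_of_lt hy)
      rw [this.deriv_eq]
      simp
  exact (mul_le_mul_right h1 _).trans (key.trans h2.le)

/-- Multiplying a density on `[0, 1]`, symmetric about `1 / 2`, by a symmetric weight that is
non-increasing away from `1 / 2` does not decrease the Poincaré constant. -/
theorem poincareConst_withDensity_le_mul_antitone {ω : ℝ → ℝ≥0∞} (hω : Measurable ω)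
    [IsFiniteMeasure ((volume : Measure ℝ).withDensity ω)]
    (hsymm : ∀ u, ω (1 - u) = ω u) (hsupp : ∀ u ∉ Set.Icc (0 : ℝ) 1, ω u = 0)
    {ρ : ℝ → ℝ} (hρm : Measurable ρ) (hρ0 : ∀ u, 0 ≤ ρ u) (hρs : ∀ u, ρ (1 - u) = ρ u)
    (hρ : AntitoneOn ρ (Set.Ici (1 / 2)))
    [IsFiniteMeasure ((volume : Measure ℝ).withDensity fun u => ω u * ENNReal.ofReal (ρ u))] :
    poincareConst ((volume : Measure ℝ).withDensity ω) ≤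
      poincareConst ((volume : Measure ℝ).withDensity fun u => ω u * ENNReal.ofReal (ρ u)) := by
  set k := poincareConst ((volume : Measure ℝ).withDensity ω)
  have hωρ : Measurable fun u => ω u * ENNReal.ofReal (ρ u) := hω.mul hρm.ennreal_ofReal
  have half : ∀ g : ℝ → ℝ, LocallyLipschitz g → g (1 / 2) = 0 →
      k * ∫⁻ u in Set.Ici (1 / 2), ω u * ENNReal.ofReal (ρ u) * ‖g u‖ₑ ^ 2 ≤
        ∫⁻ u in Set.Ici (1 / 2), ω u * ENNReal.ofReal (ρ u) * ‖deriv g u‖ₑ ^ 2 := by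
    intro g hg hg0
    have hgm : Measurable fun u => ω u * ‖g u‖ₑ ^ 2 := by have := hg.continuous; fun_prop
    have hdm : Measurable fun u => ω u * ‖deriv g u‖ₑ ^ 2 := by
      have := measurable_deriv g; fun_prop
    have := setLIntegral_antitone_mul_le (hgm.const_mul k) hdm (x₀ := 1 / 2) (fun t ht => by
      rw [lintegral_const_mul _ hgm]
      exact poincareConst_mul_setLIntegral_Icc_le hω hsymm hsupp hg hg0 ht) hρm hρ0 hρ
    simp only [mul_assoc] at this
    rw [lintegral_const_mul _ (by have := hg.continuous; fun_prop)] at this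
    simpa only [mul_assoc, mul_comm (ENNReal.ofReal _)] using this
  -- Subtracting `f (1 / 2)` makes `f` and its reflection vanish at `1 / 2`; `half` then applies to
  -- each, and the two halves add up.
  refine le_poincareConst_of_Icc (withDensity_absolutelyContinuous _ _)
    (withDensity_compl_Icc_eq_zero fun u hu => by rw [hsupp u hu, zero_mul]) fun f hf =>
      ⟨f (1 / 2), ?_⟩
  have hg : LocallyLipschitz fun u => f u - f (1 / 2) := hf.fun_sub (.const _)
  have hr : LocallyLipschitz fun u : ℝ => 1 - u := (LocallyLipschitz.const 1).fun_sub .id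
  have h1 := half _ hg (sub_self _)
  have h2 := half _ (hg.comp hr) (by norm_num)
  simp only [Function.comp_def, deriv_sub_const] at h1 h2
  have hd : ∀ u, ‖deriv (fun x => f (1 - x)) u‖ₑ = ‖deriv f (1 - u)‖ₑ := fun u => by
    rw [deriv_comp_const_sub, enorm_neg]
  simp only [hd] at h2
  rw [lintegral_withDensity_eq_lintegral_mul _ hωρ (by have := hf.continuous; fun_prop),
    lintegral_withDensity_eq_lintegral_mul _ hωρ (by have := measurable_deriv f; fun_prop),
    lintegral_eq_setLIntegral_Ici_half_add, lintegral_eq_setLIntegral_Ici_half_add]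
  simp only [Pi.mul_apply, hsymm, hρs]
  exact (mul_add _ _ _).trans_le (add_le_add h1 h2)

/-! ### Bounded perturbations and positivity -/

/-- Stability of the Poincaré constant under a bounded change of density. -/
theorem poincareConst_le_of_smul_le_of_le_smul {μ ν : Measure ℝ} [IsFiniteMeasure μ]
    [IsFiniteMeasure ν] (hμ : μ ≪ volume) (hν : ν ≪ volume) {a b : ℝ}
    (hμab : μ (Set.Icc a b)ᶜ = 0) (hνab : ν (Set.Icc a b)ᶜ = 0) {m M : ℝ≥0∞}
    (hm : m ≠ 0) (hm' : m ≠ ∞) (hM : M ≠ 0) (hM' : M ≠ ∞) (h1 : m • ν ≤ μ) (h2 : μ ≤ M • ν) :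
    poincareConst μ ≤ poincareConst ν * (M / m) := by
  have h : poincareConst μ * m / M ≤ poincareConst ν := by
    -- The mean for `μ`, not `ν`: the Poincaré inequality is applied for `μ`, while for `ν` any
    -- constant will do.
    refine le_poincareConst_of_Icc hν hνab fun f hf => ⟨⨍ x, f x ∂μ, ?_⟩
    set c := ⨍ x, f x ∂μ
    have key := poincareConst_mul_le_of_Icc hμ hμab (f := fun x => f x - c)
      (hf.fun_sub (.const _)) (integral_sub_average μ f)
    simp only [deriv_sub_const] at key
    rw [div_eq_mul_inv, mul_right_comm, ← div_eq_mul_inv, ENNReal.div_le_iff hM hM']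
    calc poincareConst μ * m * ∫⁻ x, ‖f x - c‖ₑ ^ 2 ∂ν
        = poincareConst μ * ∫⁻ x, ‖f x - c‖ₑ ^ 2 ∂(m • ν) := by
          rw [lintegral_smul_measure, smul_eq_mul, mul_assoc]
      _ ≤ poincareConst μ * ∫⁻ x, ‖f x - c‖ₑ ^ 2 ∂μ :=
          mul_le_mul_right (lintegral_mono' h1 le_rfl) _
      _ ≤ ∫⁻ x, ‖deriv f x‖ₑ ^ 2 ∂μ := key
      _ ≤ ∫⁻ x, ‖deriv f x‖ₑ ^ 2 ∂(M • ν) := lintegral_mono' h2 le_rfl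
      _ = (∫⁻ x, ‖deriv f x‖ₑ ^ 2 ∂ν) * M := by
          rw [lintegral_smul_measure, smul_eq_mul, mul_comm]
  rw [ENNReal.div_le_iff hM hM'] at h
  rwa [← mul_div_assoc, ENNReal.le_div_iff_mul_le (Or.inl hm) (Or.inl hm')]

/-- Bound `|f x - f 0|` by the integral of `|f'|` and use Cauchy–Schwarz. The constant is not sharp;
only its positivity is needed. -/
theorem one_le_poincareConst_unitInterval :
    1 ≤ poincareConst ((volume : Measure ℝ).restrict (Set.Icc 0 1)) := by
  refine le_poincareConst_of_Icc (a := 0) (b := 1) Measure.absolutelyContinuous_restrict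
    (by simp [Measure.restrict_apply measurableSet_Icc.compl]) fun f hf => ⟨f 0, ?_⟩
  have hd : Measurable fun x => ‖deriv f x‖ₑ := (measurable_deriv f).enorm
  set E := ∫⁻ x in Set.Icc (0 : ℝ) 1, ‖deriv f x‖ₑ ^ 2
  have hCS : (∫⁻ x in Set.Icc (0 : ℝ) 1, ‖deriv f x‖ₑ) ^ 2 ≤ E := by
    have h := ENNReal.lintegral_mul_le_Lp_mul_Lq (volume.restrict (Set.Icc (0 : ℝ) 1))
      Real.HolderConjugate.two_two hd.aemeasurable (g := fun _ => 1) aemeasurable_const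
    simp only [Pi.mul_apply, mul_one, ENNReal.one_rpow, lintegral_const, Measure.restrict_apply_univ,
      Real.volume_Icc, sub_zero, ENNReal.ofReal_one, ENNReal.rpow_two, one_pow] at h
    calc _ ≤ (E ^ (1 / 2 : ℝ)) ^ 2 := pow_le_pow_left' h 2
      _ = E := by rw [← ENNReal.rpow_two, ← ENNReal.rpow_mul]; norm_num
  have hpt : ∀ x ∈ Set.Icc (0 : ℝ) 1, ‖f x - f 0‖ₑ ^ 2 ≤ E := by
    intro x hx
    refine le_trans ?_ hCS
    gcongr
    obtain ⟨C, hC⟩ := hf.exists_lipschitzOnWith_Icc 0 x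
    rw [← Set.uIcc_of_le hx.1] at hC
    rw [← hC.absolutelyContinuousOnInterval.integral_deriv_eq_sub,
      intervalIntegral.integral_of_le hx.1]
    refine (enorm_integral_le_lintegral_enorm _).trans (lintegral_mono_set ?_)
    exact fun y hy => ⟨hy.1.le, hy.2.trans hx.2⟩
  rw [one_mul]
  calc _ ≤ ∫⁻ _ in Set.Icc (0 : ℝ) 1, E := setLIntegral_mono measurable_const hpt
    _ = E := by simp

/-! ### Monotonicity of the ratio of sines -/

/-- The numerator of the derivative vanishes at `v = 0` and has derivative `(a² - b²) sin(b v) sin(a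
v) ≤ 0`, so it is non-positive. -/
theorem antitoneOn_sin_mul_div_sin_mul {a b : ℝ} (ha : 0 < a) (hab : a ≤ b) (ha' : a < Real.pi)
    (hb : b ≤ Real.pi) :
    AntitoneOn (fun v => Real.sin (b * v) / Real.sin (a * v)) (Set.Icc (1 / 2) 1) := by
  have hsin : ∀ {c v : ℝ}, 0 < c → c ≤ Real.pi → 0 ≤ v → v ≤ 1 → 0 ≤ Real.sin (c * v) :=
    fun hc hc' h0 h1 => Real.sin_nonneg_of_nonneg_of_le_pi (by positivity) (by nlinarith)
  -- The interval starts at `0`, where the numerator is zero, rather than at `1 / 2`.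
  have hnum : AntitoneOn (fun v => b * Real.cos (b * v) * Real.sin (a * v) -
      Real.sin (b * v) * (a * Real.cos (a * v))) (Set.Icc 0 1) := by
    have hder : ∀ v, HasDerivAt (fun v => b * Real.cos (b * v) * Real.sin (a * v) -
        Real.sin (b * v) * (a * Real.cos (a * v)))
        ((a ^ 2 - b ^ 2) * (Real.sin (b * v) * Real.sin (a * v))) v := fun v => by
      have hl : ∀ c : ℝ, HasDerivAt (fun v => c * v) c v := fun c => by
        simpa using (hasDerivAt_id v).const_mul c
      convert! (((hl b).cos.const_mul b).mul (hl a).sin).sub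
        ((hl b).sin.mul ((hl a).cos.const_mul a)) using 1
      ring
    refine antitoneOn_of_deriv_nonpos (convex_Icc 0 1)
      (fun v _ => (hder v).continuousAt.continuousWithinAt)
      (fun v _ => (hder v).differentiableAt.differentiableWithinAt) fun v hv => ?_
    rw [interior_Icc] at hv
    rw [(hder v).deriv]
    exact mul_nonpos_of_nonpos_of_nonneg (by nlinarith) (mul_nonneg
      (hsin (ha.trans_le hab) hb hv.1.le hv.2.le) (hsin ha ha'.le hv.1.le hv.2.le))
  have hder : ∀ v ∈ Set.Icc (1 / 2 : ℝ) 1,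
      HasDerivAt (fun v => Real.sin (b * v) / Real.sin (a * v))
        ((b * Real.cos (b * v) * Real.sin (a * v) - Real.sin (b * v) * (a * Real.cos (a * v))) /
          Real.sin (a * v) ^ 2) v := fun v hv => by
    have hl : ∀ c : ℝ, HasDerivAt (fun v => c * v) c v := fun c => by
      simpa using (hasDerivAt_id v).const_mul c
    have hpos : 0 < Real.sin (a * v) := Real.sin_pos_of_pos_of_lt_pi
      (mul_pos ha (by linarith [hv.1])) (by nlinarith [hv.2])
    convert! (hl b).sin.div (hl a).sin hpos.ne' using 1
    ring
  refine antitoneOn_of_deriv_nonpos (convex_Icc _ 1)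
    (fun v hv => (hder v hv).continuousAt.continuousWithinAt)
    (fun v hv => (hder v (interior_subset hv)).differentiableAt.differentiableWithinAt)
    fun v hv => ?_
  have hv' := interior_subset hv
  rw [(hder v hv').deriv]
  refine div_nonpos_of_nonpos_of_nonneg ?_ (sq_nonneg _)
  have h0 : (0 : ℝ) ≤ v := by linarith [hv'.1]
  simpa using hnum (Set.left_mem_Icc.2 zero_le_one) ⟨h0, hv'.2⟩ h0

/-! ### The rescaled model densities -/

/-- The distance from `1 / 2` shifted by `1 / 2`, clamped to `[1 / 2, 1]`. -/
noncomputable def foldedCoord (u : ℝ) : ℝ := min (max u (1 - u)) 1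

theorem foldedCoord_mem (u : ℝ) : foldedCoord u ∈ Set.Icc (1 / 2 : ℝ) 1 := by
  refine ⟨le_min ?_ (by norm_num), min_le_right _ _⟩
  rcases le_total u (1 - u) with h | h
  · rw [max_eq_right h]; linarith
  · rw [max_eq_left h]; linarith

theorem foldedCoord_one_sub (u : ℝ) : foldedCoord (1 - u) = foldedCoord u := by
  simp [foldedCoord, max_comm]

theorem monotoneOn_foldedCoord : MonotoneOn foldedCoord (Set.Ici (1 / 2)) := by
  intro u hu v hv huv
  have hu : 1 / 2 ≤ u := hu
  have hv : 1 / 2 ≤ v := hv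
  rw [foldedCoord, foldedCoord, max_eq_left (by linarith), max_eq_left (by linarith)]
  exact min_le_min_right _ huv

theorem measurable_foldedCoord : Measurable foldedCoord := by
  unfold foldedCoord; fun_prop

/-- The model density of parameter `c = √κ D`, rescaled to `[0, 1]`, up to a constant factor. -/
noncomputable def sinDensity (p c u : ℝ) : ℝ≥0∞ :=
  (Set.Icc (0 : ℝ) 1).indicator (fun u => ENNReal.ofReal (Real.sin (c * foldedCoord u) ^ p)) u

theorem measurable_sinDensity (p c : ℝ) : Measurable (sinDensity p c) := by
  refine Measurable.indicator ?_ measurableSet_Icc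
  have := measurable_foldedCoord
  fun_prop

theorem sinDensity_one_sub (p c u : ℝ) : sinDensity p c (1 - u) = sinDensity p c u := by
  have h : 1 - u ∈ Set.Icc (0 : ℝ) 1 ↔ u ∈ Set.Icc (0 : ℝ) 1 := by
    constructor <;> rintro ⟨h1, h2⟩ <;> constructor <;> linarith
  by_cases hu : u ∈ Set.Icc (0 : ℝ) 1
  · simp only [sinDensity, Set.indicator_of_mem hu, Set.indicator_of_mem (h.2 hu),
      foldedCoord_one_sub]
  · simp only [sinDensity, Set.indicator_of_notMem hu, Set.indicator_of_notMem (mt h.1 hu)]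

theorem sinDensity_eq_zero {p c u : ℝ} (hu : u ∉ Set.Icc (0 : ℝ) 1) : sinDensity p c u = 0 :=
  Set.indicator_of_notMem hu _

theorem sin_mul_foldedCoord_nonneg {c : ℝ} (hc : 0 < c) (hc' : c ≤ Real.pi) (u : ℝ) :
    0 ≤ Real.sin (c * foldedCoord u) := by
  have h := foldedCoord_mem u
  exact Real.sin_nonneg_of_nonneg_of_le_pi (mul_nonneg hc.le (by linarith [h.1]))
    (by nlinarith [h.2])

theorem sin_mul_pos {c v : ℝ} (hc : 0 < c) (hc' : c < Real.pi) (hv : v ∈ Set.Icc (1 / 2 : ℝ) 1) :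
    0 < Real.sin (c * v) :=
  Real.sin_pos_of_pos_of_lt_pi (mul_pos hc (by linarith [hv.1])) (by nlinarith [hv.2])

theorem sinDensity_le {p c : ℝ} (hp : 0 < p) (hc : 0 < c) (hc' : c ≤ Real.pi) (u : ℝ) :
    sinDensity p c u ≤ (Set.Icc (0 : ℝ) 1).indicator (fun _ => 1) u := by
  refine Set.indicator_le_indicator ?_
  rw [ENNReal.ofReal_le_one]
  exact Real.rpow_le_one (sin_mul_foldedCoord_nonneg hc hc' u) (Real.sin_le_one _) hp.le

theorem withDensity_indicator_Icc_const (k : ℝ≥0∞) :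
    (volume : Measure ℝ).withDensity ((Set.Icc (0 : ℝ) 1).indicator fun _ => k) =
      k • (volume : Measure ℝ).restrict (Set.Icc (0 : ℝ) 1) := by
  rw [withDensity_indicator measurableSet_Icc, withDensity_const]

theorem withDensity_sinDensity_le {p c : ℝ} (hp : 0 < p) (hc : 0 < c) (hc' : c ≤ Real.pi) :
    (volume : Measure ℝ).withDensity (sinDensity p c) ≤ volume.restrict (Set.Icc (0 : ℝ) 1) := by
  rw [← one_smul ℝ≥0∞ (volume.restrict (Set.Icc (0 : ℝ) 1)), ← withDensity_indicator_Icc_const]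
  exact withDensity_mono (ae_of_all _ (sinDensity_le hp hc hc'))

theorem isFiniteMeasure_sinDensity {p c : ℝ} (hp : 0 < p) (hc : 0 < c) (hc' : c ≤ Real.pi) :
    IsFiniteMeasure ((volume : Measure ℝ).withDensity (sinDensity p c)) :=
  isFiniteMeasure_of_le _ (withDensity_sinDensity_le hp hc hc')

theorem withDensity_sinDensity_compl (p c : ℝ) :
    (volume : Measure ℝ).withDensity (sinDensity p c) (Set.Icc 0 1)ᶜ = 0 :=
  withDensity_compl_Icc_eq_zero fun _ => sinDensity_eq_zero

/-- For `c < π` the sine has a positive minimum on `[c/2, c]`, so the density is comparable to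
Lebesgue measure on `[0, 1]`. -/
theorem poincareConst_sinDensity_pos {p c : ℝ} (hp : 0 < p) (hc : 0 < c) (hc' : c < Real.pi) :
    0 < poincareConst ((volume : Measure ℝ).withDensity (sinDensity p c)) := by
  have := isFiniteMeasure_sinDensity hp hc hc'.le
  obtain ⟨v, hv, hmin⟩ := isCompact_Icc.exists_isMinOn (s := Set.Icc (1 / 2 : ℝ) 1)
    (Set.nonempty_Icc.2 (by norm_num)) (f := fun v => Real.sin (c * v)) (by fun_prop)
  set m := Real.sin (c * v) ^ p
  have hm : 0 < m := Real.rpow_pos_of_pos (sin_mul_pos hc hc' hv) p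
  have hm0 : ENNReal.ofReal m ≠ 0 := by simpa using hm
  have hlow : ENNReal.ofReal m • (volume : Measure ℝ).restrict (Set.Icc (0 : ℝ) 1) ≤
      (volume : Measure ℝ).withDensity (sinDensity p c) := by
    rw [← withDensity_indicator_Icc_const]
    refine withDensity_mono (ae_of_all _ fun u => Set.indicator_le_indicator ?_)
    exact ENNReal.ofReal_le_ofReal (Real.rpow_le_rpow (sin_mul_pos hc hc' hv).le
      (hmin (foldedCoord_mem u)) hp.le)
  have h1 : (1 : ℝ≥0∞) • (volume : Measure ℝ).withDensity (sinDensity p c) ≤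
      volume.restrict (Set.Icc (0 : ℝ) 1) := by
    rw [one_smul]; exact withDensity_sinDensity_le hp hc hc'.le
  have h2 : (volume : Measure ℝ).restrict (Set.Icc (0 : ℝ) 1) ≤
      (ENNReal.ofReal m)⁻¹ • (volume : Measure ℝ).withDensity (sinDensity p c) := by
    calc _ = (ENNReal.ofReal m)⁻¹ • ENNReal.ofReal m •
          (volume : Measure ℝ).restrict (Set.Icc (0 : ℝ) 1) := by
          rw [smul_smul, ENNReal.inv_mul_cancel hm0 ENNReal.ofReal_ne_top, one_smul]
      _ ≤ _ := Measure.le_iff.2 fun s hs => mul_le_mul_right (Measure.le_iff.1 hlow s hs) _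
  have h := one_le_poincareConst_unitInterval.trans (poincareConst_le_of_smul_le_of_le_smul
    Measure.absolutelyContinuous_restrict (withDensity_absolutelyContinuous _ _)
    (by simp [Measure.restrict_apply measurableSet_Icc.compl]) (withDensity_sinDensity_compl p c)
    one_ne_zero ENNReal.one_ne_top (by simp) (ENNReal.inv_ne_top.2 hm0) h1 h2)
  rw [pos_iff_ne_zero]
  intro h0
  simp [h0] at h

/-- The weight relating two rescaled model densities. -/
noncomputable def sinRatio (p a b u : ℝ) : ℝ :=
  (Real.sin (b * foldedCoord u) / Real.sin (a * foldedCoord u)) ^ p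

theorem sinRatio_base_nonneg {a b : ℝ} (ha : 0 < a) (hab : a ≤ b) (hb : b ≤ Real.pi) (u : ℝ) :
    0 ≤ Real.sin (b * foldedCoord u) / Real.sin (a * foldedCoord u) :=
  div_nonneg (sin_mul_foldedCoord_nonneg (ha.trans_le hab) hb u)
    (sin_mul_foldedCoord_nonneg ha (hab.trans hb) u)

theorem antitoneOn_sinRatio {p a b : ℝ} (hp : 0 < p) (ha : 0 < a) (hab : a ≤ b)
    (ha' : a < Real.pi) (hb : b ≤ Real.pi) : AntitoneOn (sinRatio p a b) (Set.Ici (1 / 2)) :=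
  fun u hu v hv huv => Real.rpow_le_rpow (sinRatio_base_nonneg ha hab hb v)
    (antitoneOn_sin_mul_div_sin_mul ha hab ha' hb (foldedCoord_mem u) (foldedCoord_mem v)
      (monotoneOn_foldedCoord hu hv huv)) hp.le

theorem measurable_sinRatio (p a b : ℝ) : Measurable (sinRatio p a b) := by
  have := measurable_foldedCoord
  unfold sinRatio
  fun_prop

theorem sinDensity_mul_sinRatio {p a b : ℝ} (ha : 0 < a) (hab : a ≤ b)
    (ha' : a < Real.pi) (hb : b ≤ Real.pi) :
    (fun u => sinDensity p a u * ENNReal.ofReal (sinRatio p a b u)) = sinDensity p b := by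
  ext u
  by_cases hu : u ∈ Set.Icc (0 : ℝ) 1
  · have hpos := sin_mul_pos ha ha' (foldedCoord_mem u)
    simp only [sinDensity, Set.indicator_of_mem hu, sinRatio]
    rw [← ENNReal.ofReal_mul (Real.rpow_nonneg hpos.le _),
      ← Real.mul_rpow hpos.le (sinRatio_base_nonneg ha hab hb u), mul_div_cancel₀ _ hpos.ne']
  · simp only [sinDensity_eq_zero hu, zero_mul]

theorem poincareConst_sinDensity_mono {p a b : ℝ} (hp : 0 < p) (ha : 0 < a) (hab : a ≤ b)
    (ha' : a < Real.pi) (hb : b ≤ Real.pi) :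
    poincareConst ((volume : Measure ℝ).withDensity (sinDensity p a)) ≤
      poincareConst ((volume : Measure ℝ).withDensity (sinDensity p b)) := by
  have heq := sinDensity_mul_sinRatio (p := p) ha hab ha' hb
  have := isFiniteMeasure_sinDensity hp ha ha'.le
  have : IsFiniteMeasure ((volume : Measure ℝ).withDensity
      fun u => sinDensity p a u * ENNReal.ofReal (sinRatio p a b u)) := by
    rw [heq]; exact isFiniteMeasure_sinDensity hp (ha.trans_le hab) hb
  have h := poincareConst_withDensity_le_mul_antitone (measurable_sinDensity p a)
    (sinDensity_one_sub p a) (fun _ => sinDensity_eq_zero) (measurable_sinRatio p a b)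
    (fun u => Real.rpow_nonneg (sinRatio_base_nonneg ha hab hb u) _)
    (fun u => by simp only [sinRatio, foldedCoord_one_sub]) (antitoneOn_sinRatio hp ha hab ha' hb)
  rwa [heq] at h

/-- The weight is largest at `v = 1 / 2` and smallest at `v = 1`; `b < π` keeps the smallest value
positive. -/
theorem poincareConst_sinDensity_le {p a b : ℝ} (hp : 0 < p) (ha : 0 < a) (hab : a ≤ b)
    (hb : b < Real.pi) :
    poincareConst ((volume : Measure ℝ).withDensity (sinDensity p b)) ≤
      poincareConst ((volume : Measure ℝ).withDensity (sinDensity p a)) *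
        (ENNReal.ofReal ((Real.sin (b * (1 / 2)) / Real.sin (a * (1 / 2))) ^ p) /
          ENNReal.ofReal ((Real.sin (b * 1) / Real.sin (a * 1)) ^ p)) := by
  have ha' := hab.trans_lt hb
  have heq := sinDensity_mul_sinRatio (p := p) ha hab ha' hb.le
  have := isFiniteMeasure_sinDensity hp ha ha'.le
  have := isFiniteMeasure_sinDensity hp (ha.trans_le hab) hb.le
  have hanti := antitoneOn_sin_mul_div_sin_mul ha hab ha' hb.le
  have hleft : (1 / 2 : ℝ) ∈ Set.Icc (1 / 2 : ℝ) 1 := ⟨le_rfl, by norm_num⟩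
  have hright : (1 : ℝ) ∈ Set.Icc (1 / 2 : ℝ) 1 := ⟨by norm_num, le_rfl⟩
  have hpos : ∀ v ∈ Set.Icc (1 / 2 : ℝ) 1, 0 < Real.sin (b * v) / Real.sin (a * v) := fun v hv =>
    div_pos (sin_mul_pos (ha.trans_le hab) hb hv) (sin_mul_pos ha ha' hv)
  have hne : ∀ v ∈ Set.Icc (1 / 2 : ℝ) 1,
      ENNReal.ofReal ((Real.sin (b * v) / Real.sin (a * v)) ^ p) ≠ 0 := fun v hv => by
    simpa using Real.rpow_pos_of_pos (hpos v hv) p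
  refine poincareConst_le_of_smul_le_of_le_smul (withDensity_absolutelyContinuous _ _)
    (withDensity_absolutelyContinuous _ _) (withDensity_sinDensity_compl p b)
    (withDensity_sinDensity_compl p a) (hne 1 hright) ENNReal.ofReal_ne_top (hne _ hleft)
    ENNReal.ofReal_ne_top ?_ ?_
  · rw [← withDensity_smul _ (measurable_sinDensity p a), ← heq]
    refine withDensity_mono (ae_of_all _ fun u => ?_)
    rw [Pi.smul_apply, smul_eq_mul, mul_comm]
    exact mul_le_mul_right (ENNReal.ofReal_le_ofReal (Real.rpow_le_rpow (hpos 1 hright).le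
      (hanti (foldedCoord_mem u) hright (foldedCoord_mem u).2) hp.le)) _
  · rw [← withDensity_smul _ (measurable_sinDensity p a), ← heq]
    refine withDensity_mono (ae_of_all _ fun u => ?_)
    rw [Pi.smul_apply, smul_eq_mul, mul_comm _ (sinDensity p a u)]
    exact mul_le_mul_right (ENNReal.ofReal_le_ofReal (Real.rpow_le_rpow
      (sinRatio_base_nonneg ha hab hb.le u)
      (hanti hleft (foldedCoord_mem u) (foldedCoord_mem u).1) hp.le)) _

/-! ### Back to the model densities and the distortion coefficients -/

theorem poincareConst_smul {μ : Measure ℝ} {c : ℝ≥0∞} (hμ : μ ≪ volume) (hc : c ≠ 0)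
    (hc' : c ≠ ∞) : poincareConst (c • μ) = poincareConst μ := by
  have key : ∀ {ν : Measure ℝ} {k : ℝ≥0∞}, ν ≪ volume → k ≠ 0 → k ≠ ∞ →
      poincareConst (k • ν) ≤ poincareConst ν := by
    intro ν k hν hk hk'
    refine le_poincareConst hν fun f hf hi h0 h2 => ?_
    have h := poincareConst_mul_le (μ := k • ν) (Measure.smul_absolutelyContinuous.trans hν) hf
      (hi.smul_measure hk') (by rw [integral_smul_measure, h0, smul_zero])
      (by rw [lintegral_smul_measure]; exact ENNReal.mul_lt_top hk'.lt_top h2)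
    rwa [lintegral_smul_measure, lintegral_smul_measure, smul_eq_mul, smul_eq_mul, mul_left_comm,
      ENNReal.mul_le_mul_iff_right hk hk'] at h
  refine le_antisymm (key hμ hc hc') ?_
  have h := key (Measure.smul_absolutelyContinuous.trans hμ) (ENNReal.inv_ne_zero.2 hc')
    (ENNReal.inv_ne_top.2 hc) (ν := c • μ)
  rwa [smul_smul, ENNReal.inv_mul_cancel hc hc', one_smul] at h

theorem sFun_of_pos {κ : ℝ} (hκ : 0 < κ) (θ : ℝ) : sFun κ θ = (1 / √κ) * Real.sin (√κ * θ) :=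
  if_pos hκ

/-- On both halves `sFun` is evaluated at `D * foldedCoord u`, since `D - D u = D (1 - u)`. -/
theorem modelDensity_mul {K N D : ℝ} (hκ : 0 < K / (N - 1)) (hD : 0 < D)
    (hD' : √(K / (N - 1)) * D ≤ Real.pi) (u : ℝ) :
    ENNReal.ofReal (modelDensity K N D (D * u)) =
      ENNReal.ofReal ((1 / √(K / (N - 1))) ^ (N - 1)) *
        sinDensity (N - 1) (√(K / (N - 1)) * D) u := by
  set q := √(K / (N - 1)) with hq_def
  have hq : 0 < q := Real.sqrt_pos.2 hκ
  have hval : ∀ x, x = D * foldedCoord u → ENNReal.ofReal (sFun (K / (N - 1)) x ^ (N - 1)) =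
      ENNReal.ofReal ((1 / q) ^ (N - 1)) *
        ENNReal.ofReal (Real.sin (q * D * foldedCoord u) ^ (N - 1)) := by
    rintro _ rfl
    rw [sFun_of_pos hκ, ← hq_def, ← mul_assoc q, Real.mul_rpow (by positivity)
      (sin_mul_foldedCoord_nonneg (by positivity) hD' u), ENNReal.ofReal_mul (by positivity)]
  rw [modelDensity, sinDensity]
  by_cases h1 : D * u ∈ Set.Icc 0 (D / 2)
  · have hu0 : 0 ≤ u := nonneg_of_mul_nonneg_right h1.1 hD
    have hu1 : u ≤ 1 / 2 := le_of_mul_le_mul_left (by linarith [h1.2]) hD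
    rw [if_pos h1, Set.indicator_of_mem (Set.mem_Icc.2 ⟨hu0, by linarith⟩)]
    refine hval _ ?_
    rw [foldedCoord, max_eq_right (by linarith), min_eq_left (by linarith)]
    ring
  rw [if_neg h1]
  by_cases h2 : D * u ∈ Set.Icc (D / 2) D
  · have hu0 : 1 / 2 ≤ u := le_of_mul_le_mul_left (by linarith [h2.1]) hD
    have hu1 : u ≤ 1 := le_of_mul_le_mul_left (by linarith [h2.2]) hD
    rw [if_pos h2, Set.indicator_of_mem (Set.mem_Icc.2 ⟨by linarith, hu1⟩)]
    refine hval _ ?_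
    rw [foldedCoord, max_eq_left (by linarith), min_eq_left hu1]
  · rw [if_neg h2, Set.indicator_of_notMem, ENNReal.ofReal_zero, mul_zero]
    rintro ⟨hu0, hu1⟩
    rcases le_total u (1 / 2) with h | h
    · exact h1 ⟨by positivity, by nlinarith⟩
    · exact h2 ⟨by nlinarith, by nlinarith⟩

/-- Rescaling the model space to the unit interval. -/
theorem sq_mul_densityPoincareConst_modelDensity {K N D : ℝ} (hκ : 0 < K / (N - 1))
    (hD : 0 < D) (hD' : √(K / (N - 1)) * D ≤ Real.pi) :
    ENNReal.ofReal (D ^ 2) * densityPoincareConst (modelDensity K N D) =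
      poincareConst ((volume : Measure ℝ).withDensity
        (sinDensity (N - 1) (√(K / (N - 1)) * D))) := by
  have hq : 0 < √(K / (N - 1)) := Real.sqrt_pos.2 hκ
  rw [densityPoincareConst, ← poincareConst_withDensity_comp_mul hD]
  simp only [modelDensity_mul hκ hD hD']
  rw [← poincareConst_smul (c := ENNReal.ofReal ((1 / √(K / (N - 1))) ^ (N - 1)))
    (withDensity_absolutelyContinuous _ (sinDensity _ _)) (by simp; positivity) ENNReal.ofReal_ne_top,
    ← withDensity_smul _ (measurable_sinDensity _ _)]
  rfl

theorem ofReal_lt_bonnetMyersDiam_iff {K N D : ℝ} (hK : 0 < K) (hκ : 0 < K / (N - 1)) :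
    ENNReal.ofReal D < bonnetMyersDiam K N ↔ √(K / (N - 1)) * D < Real.pi := by
  have hq : 0 < √(K / (N - 1)) := Real.sqrt_pos.2 hκ
  rw [bonnetMyersDiam, if_pos hK, ENNReal.ofReal_lt_ofReal_iff (div_pos Real.pi_pos hq),
    lt_div_iff₀' hq]

theorem ofReal_le_bonnetMyersDiam_iff {K N D : ℝ} (hK : 0 < K) (hκ : 0 < K / (N - 1)) :
    ENNReal.ofReal D ≤ bonnetMyersDiam K N ↔ √(K / (N - 1)) * D ≤ Real.pi := by
  have hq : 0 < √(K / (N - 1)) := Real.sqrt_pos.2 hκ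
  rw [bonnetMyersDiam, if_pos hK, ENNReal.ofReal_le_ofReal_iff (div_pos Real.pi_pos hq).le,
    le_div_iff₀' hq]

theorem sigmaCoeff_half_of_lt {K N D : ℝ} (hK : 0 < K) (hκ : 0 < K / (N - 1))
    (hD : √(K / (N - 1)) * D < Real.pi) :
    sigmaCoeff K N (1 / 2) D = ENNReal.ofReal
      (Real.sin (√(K / (N - 1)) * D * (1 / 2)) / Real.sin (√(K / (N - 1)) * D * 1)) := by
  have hq : 0 < √(K / (N - 1)) := Real.sqrt_pos.2 hκ
  rw [sigmaCoeff, if_neg (not_le.2 ((ofReal_lt_bonnetMyersDiam_iff hK hκ).2 hD)), sFun_of_pos hκ,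
    sFun_of_pos hκ, mul_div_mul_left _ _ (by positivity), mul_one, mul_comm (1 / 2) D, mul_assoc]

theorem mainTheorem9 (K N D' D : ℝ) (hK : 0 < K) (hN : 1 < N) (hD' : 0 < D') (hD'D : D' ≤ D)
    (hD : ENNReal.ofReal D ≤ bonnetMyersDiam K N) :
    ENNReal.ofReal (D' ^ 2) * densityPoincareConst (modelDensity K N D')
        ≤ ENNReal.ofReal (D ^ 2) * densityPoincareConst (modelDensity K N D) ∧
      (ENNReal.ofReal D' < bonnetMyersDiam K N →
        ENNReal.ofReal (D ^ 2) * densityPoincareConst (modelDensity K N D)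
          ≤ ENNReal.ofReal (D' ^ 2) * densityPoincareConst (modelDensity K N D')
            * (sigmaCoeff K N (1 / 2) D / sigmaCoeff K N (1 / 2) D') ^ (N - 1)) := by
  have hp : 0 < N - 1 := sub_pos.2 hN
  have hκ : 0 < K / (N - 1) := div_pos hK hp
  have hq : 0 < √(K / (N - 1)) := Real.sqrt_pos.2 hκ
  have hD0 : 0 < D := hD'.trans_le hD'D
  have hb := (ofReal_le_bonnetMyersDiam_iff hK hκ).1 hD
  have hab : √(K / (N - 1)) * D' ≤ √(K / (N - 1)) * D := mul_le_mul_of_nonneg_left hD'D hq.le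
  have ha : 0 < √(K / (N - 1)) * D' := mul_pos hq hD'
  rw [sq_mul_densityPoincareConst_modelDensity hκ hD0 hb,
    sq_mul_densityPoincareConst_modelDensity hκ hD' (hab.trans hb)]
  refine ⟨?_, fun hlt => ?_⟩
  -- Equality is separate because `D' = D` may be the Bonnet–Myers diameter, where `a < π` fails.
  · rcases hD'D.eq_or_lt with rfl | hlt
    · exact le_rfl
    · exact poincareConst_sinDensity_mono hp ha hab
        ((mul_lt_mul_of_pos_left hlt hq).trans_le hb) hb
  have ha' := (ofReal_lt_bonnetMyersDiam_iff hK hκ).1 hlt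
  have hleft : (1 / 2 : ℝ) ∈ Set.Icc (1 / 2 : ℝ) 1 := ⟨le_rfl, by norm_num⟩
  have hright : (1 : ℝ) ∈ Set.Icc (1 / 2 : ℝ) 1 := ⟨by norm_num, le_rfl⟩
  have hal := sin_mul_pos ha ha' hleft
  have har := sin_mul_pos ha ha' hright
  rw [sigmaCoeff_half_of_lt hK hκ ha']
  rcases hb.lt_or_eq with hb' | hb'
  · have hbl := sin_mul_pos (ha.trans_le hab) hb' hleft
    have hbr := sin_mul_pos (ha.trans_le hab) hb' hright
    refine (poincareConst_sinDensity_le hp ha hab hb').trans_eq ?_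
    rw [sigmaCoeff_half_of_lt hK hκ hb', ← ENNReal.ofReal_div_of_pos (div_pos hal har),
      ← ENNReal.ofReal_div_of_pos (Real.rpow_pos_of_pos (div_pos hbr har) _),
      ENNReal.ofReal_rpow_of_nonneg (by positivity) hp.le,
      ← Real.div_rpow (div_pos hbl hal).le (div_pos hbr har).le, div_div_div_comm]
  · have htop : sigmaCoeff K N (1 / 2) D = ∞ :=
      if_pos (not_lt.1 fun h => ((ofReal_lt_bonnetMyersDiam_iff hK hκ).1 h).ne hb')
    -- Since `0 * ∞ = 0` in `ℝ≥0∞`, the right-hand side is `∞` only because the constant for `D'` is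
    -- nonzero.
    rw [htop, ENNReal.top_div_of_ne_top ENNReal.ofReal_ne_top, ENNReal.top_rpow_of_pos hp,
      ENNReal.mul_top (poincareConst_sinDensity_pos hp ha ha').ne']
    exact le_top
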